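/- Let $n\ge 2$, $0\le l\le n-1$, and let $\lambda=(n-l,1^l)$ be a hook partition of $n$. For a $\lambda$-tableau $a$ (a bijective filling of the diagram of $\lambda$ with the entries $1,\dots,n$), let $\{a\}$ be its tabloid (the tableau with unordered rows) and let $\langle a\rangle=\sum_{\sigma\in C_a}\varepsilon_\sigma\{a\}\sigma$ be its polytabloid, where $C_a\le \mathcal S_n$ is the column stabilizer of $a$ and $\varepsilon_\sigma$ is the sign. Let $M^\lambda$ be the free $\mathbf Z$-module on the $\lambda$-tabloids, with the bilinear form $(-,=)$ for which the tabloids are orthonormal, let the Specht lattice $S^\lambda\subseteq M^\lambda$ be the $\mathbf Z$-span of the polytabloids with the restricted form, let $S^{\lambda,*}=\mathrm{Hom}_{\mathbf Z}(S^\lambda,\mathbf Z)$, and let $S^{\lambda,*}/S^\lambda$ denote the cokernel of $S^\lambda\to S^{\lambda,*}$, $\xi\mapsto(\xi,-)$. A $\lambda$-polytabloid is determined by the tuple $b=(b_0,\dots,b_l)$ of entries of the first column, read from top to bottom, and is written $\langle b\rangle$. (1) As abelian groups, $$S^{\lambda,*}/S^\lambda\;\cong\;(\mathbf Z/l!\,\mathbf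 Z)^{\binom{n-2}{l}}\oplus(\mathbf Z/n\,l!\,\mathbf Z)^{\binom{n-2}{l-1}},$$ where $\binom{a}{b}=0$ unless $a\ge b\ge 0$. (2) Let $y=(y_1,\dots,y_m)$ consist of the standard polytabloids (those of tableaux with strictly increasing rows and columns) $y_i=\langle 1,c_i\rangle$, each standard tableau occurring once, in any order such that all those without the entry $n$ in the first column come before all those with the entry $n$ in the first column. Let $x=(x_1,\dots,x_m)$ be given by $x_i=\langle n,c_i\rangle$ if $n$ does not occur in $c_i$, and by $x_i=\sum_{s\in[1,n-1]\setminus d}\langle s,d,n\rangle$ if $c_i=(d,n)$. Then $x$ and $y$ are $\mathbf Z$-linear bases of $S^\lambda$ that trigonalize the Gram matrix in the following sense: - (i) $(x_i,y_i)\ne 0$ for all $i$; - (ii) $(x_i,y_j)=0$ for $i>j$; - (iii) $(x_i,y_i)$ divides $(x_i,y_j)$ for $i<j$; - (iv) $(x_i,y_i)$ divides $(x_{i+1},y_{i+1})$ for $1\le i\le m-1$; - (v) $\prod_i (x_i,y_i)=\pm\det G$, where $G$ is the Gram matrix of the form with respect to any $\mathbf Z$-linear basis of $S^\lambda$. Moreover,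 $(x_i,y_i)=l!$ if $n$ does not occur in $c_i$, and $(x_i,y_i)=n\,l!$ if $n$ occurs in $c_i$. -/

import Mathlib

open scoped Nat

namespace Specht

/-- A tableau of shape `μ` with entries in `Fin n`: a bijective filling of the cells of `μ`, where
`(i, j)` is the cell in row `i` and column `j`, counted from `0`.
The element `k : Fin n` stands for the entry `k + 1` of `[1, n]`. -/
abbrev Tableau (μ : YoungDiagram) (n : ℕ) : Type := {c : ℕ × ℕ // c ∈ μ} ≃ Fin n

namespace Tableau

variable {μ : YoungDiagram} {n : ℕ}

/-- The row in which the entry `e` lies. -/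
def rowOf (T : Tableau μ n) (e : Fin n) : ℕ := (T.symm e).1.1

/-- The column in which the entry `e` lies. -/
def colOf (T : Tableau μ n) (e : Fin n) : ℕ := (T.symm e).1.2

/-- Entrywise operation of the symmetric group. -/
def act (T : Tableau μ n) (σ : Equiv.Perm (Fin n)) : Tableau μ n := T.trans σ

/-- Strictly increasing rows from left to right and strictly increasing columns from top to
bottom. -/
def IsStandard (T : Tableau μ n) : Prop :=
  ∀ c d : {c : ℕ × ℕ // c ∈ μ},
    ((c.1.1 = d.1.1 ∧ c.1.2 < d.1.2) ∨ (c.1.2 = d.1.2 ∧ c.1.1 < d.1.1)) → T c < T d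

end Tableau

/-- Two tableaux are row equivalent if each entry lies in the same row of both. -/
def rowSetoid (μ : YoungDiagram) (n : ℕ) : Setoid (Tableau μ n) where
  r T T' := ∀ e, T.rowOf e = T'.rowOf e
  iseqv :=
    { refl := fun _ _ => rfl
      symm := fun h e => (h e).symm
      trans := fun h h' e => (h e).trans (h' e) }

/-- A tabloid is a tableau with unordered rows. -/
def Tabloid (μ : YoungDiagram) (n : ℕ) : Type := Quotient (rowSetoid μ n)

/-- The tabloid `{T}` of a tableau `T`. -/
def Tableau.tabloid {μ : YoungDiagram} {n : ℕ} (T : Tableau μ n) : Tabloid μ n :=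
  Quotient.mk (rowSetoid μ n) T

/-- The free abelian group `M^μ` on the set of tabloids of shape `μ`. -/
abbrev TabloidModule (μ : YoungDiagram) (n : ℕ) : Type := Tabloid μ n →₀ ℤ

/-- The bilinear form on `M^μ` for which the tabloids form an orthonormal basis. -/
noncomputable def tabloidForm (μ : YoungDiagram) (n : ℕ) :
    LinearMap.BilinForm ℤ (TabloidModule μ n) :=
  Finsupp.linearCombination ℤ fun t => (Finsupp.lapply t : TabloidModule μ n →ₗ[ℤ] ℤ)

open Classical in
theorem tabloidForm_single (μ : YoungDiagram) (n : ℕ) (s t : Tabloid μ n) :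
    tabloidForm μ n (Finsupp.single s 1) (Finsupp.single t 1) = if s = t then 1 else 0 := by
  simp [tabloidForm, Finsupp.single_apply, eq_comm]

/-- The polytabloid `⟨T⟩`: the signed sum of the tabloids `{T}σ`, where `σ` runs over the column
stabilizer of `T`. -/
noncomputable def polytabloid {μ : YoungDiagram} {n : ℕ} (T : Tableau μ n) : TabloidModule μ n :=
  ∑ σ : Equiv.Perm (Fin n) with ∀ e, T.colOf (σ e) = T.colOf e,
    (Equiv.Perm.sign σ : ℤ) • Finsupp.single (T.act σ).tabloid (1 : ℤ)

/-- The Specht lattice `S^μ`: the `ℤ`-linear span of the polytabloids in `M^μ`. -/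
noncomputable def lattice (μ : YoungDiagram) (n : ℕ) : Submodule ℤ (TabloidModule μ n) :=
  Submodule.span ℤ (Set.range fun T : Tableau μ n => polytabloid T)

/-- The polytabloid of `T` as an element of the Specht lattice. -/
noncomputable def poly {μ : YoungDiagram} {n : ℕ} (T : Tableau μ n) : lattice μ n :=
  ⟨polytabloid T, Submodule.subset_span ⟨T, rfl⟩⟩

/-- The restriction of the bilinear form to the Specht lattice. As a linear map from `S^μ` to its
dual, it is the map `η : ξ ↦ (ξ, -)`. -/
noncomputable def form (μ : YoungDiagram) (n : ℕ) : LinearMap.BilinForm ℤ (lattice μ n) :=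
  (tabloidForm μ n).restrict (lattice μ n)

/-- The cokernel `S^{μ,*}/S^μ` of `η : S^μ → S^{μ,*}`. -/
abbrev DualQuotient (μ : YoungDiagram) (n : ℕ) : Type :=
  Module.Dual ℤ (lattice μ n) ⧸ LinearMap.range (form μ n)

/-- Two tuples that trigonalize a bilinear form on a finitely generated free `ℤ`-module `X` of rank
`m`. In the last condition, the Gram matrix with respect to any `ℤ`-linear basis is meant. -/
structure Trigonalizes {X : Type*} [AddCommGroup X] (B : LinearMap.BilinForm ℤ X) {m : ℕ}
    (x y : Fin m → X) : Prop where
  diag_ne_zero : ∀ i, B (x i) (y i) ≠ 0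
  lower_eq_zero : ∀ i j, j < i → B (x i) (y j) = 0
  diag_dvd_upper : ∀ i j, i < j → B (x i) (y i) ∣ B (x i) (y j)
  diag_dvd_succ : ∀ (i : ℕ) (h : i + 1 < m),
    B (x ⟨i, Nat.lt_of_succ_lt h⟩) (y ⟨i, Nat.lt_of_succ_lt h⟩) ∣ B (x ⟨i + 1, h⟩) (y ⟨i + 1, h⟩)
  prod_diag : ∀ b : Module.Basis (Fin m) ℤ X,
    ∏ i, B (x i) (y i) = (Matrix.of fun i j => B (b i) (b j)).det ∨
    ∏ i, B (x i) (y i) = -(Matrix.of fun i j => B (b i) (b j)).det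

/-- The tuple `x` is a `ℤ`-linear basis. -/
def IsIntBasis {X : Type*} [AddCommGroup X] {m : ℕ} (x : Fin m → X) : Prop :=
  LinearIndependent ℤ x ∧ Submodule.span ℤ (Set.range x) = ⊤

/-- The Young diagram of the hook partition `(n - l, 1^l)` of `n`, for `l < n`. -/
def hook (n l : ℕ) : YoungDiagram where
  cells := (Finset.range (l + 1) ×ˢ {0}) ∪ ({0} ×ˢ Finset.range (n - l))
  isLowerSet := by
    rintro ⟨a, b⟩ ⟨c, d⟩ ⟨h1, h2⟩ h
    simp only [Finset.coe_union, Set.mem_union, Finset.mem_coe, Finset.mem_product,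
      Finset.mem_range, Finset.mem_singleton] at h ⊢
    simp only at h1 h2
    omega

theorem mem_hook {n l : ℕ} {c : ℕ × ℕ} :
    c ∈ hook n l ↔ (c.1 < l + 1 ∧ c.2 = 0) ∨ (c.1 = 0 ∧ c.2 < n - l) := by
  rw [← YoungDiagram.mem_cells]
  simp only [hook, Finset.mem_union, Finset.mem_product, Finset.mem_range, Finset.mem_singleton]

theorem hook_rowLen {n l : ℕ} (hl : l < n) (i : ℕ) :
    (hook n l).rowLen i = if i = 0 then n - l else if i ≤ l then 1 else 0 := by
  have key : ∀ j, j < (hook n l).rowLen i ↔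
      j < if i = 0 then n - l else if i ≤ l then 1 else 0 := by
    intro j
    rw [← YoungDiagram.mem_iff_lt_rowLen, mem_hook]
    dsimp only
    split_ifs <;> omega
  exact le_antisymm (le_of_not_gt fun h => lt_irrefl _ ((key _).1 h))
    (le_of_not_gt fun h => lt_irrefl _ ((key _).2 h))

/-- The entries of the first column of a tableau of hook shape, read from top to bottom. -/
def firstColumn {n l : ℕ} (T : Tableau (hook n l) n) (i : Fin (l + 1)) : Fin n :=
  T ⟨(i, 0), mem_hook.2 (Or.inl ⟨i.2, rfl⟩)⟩

/-- The entries of the first column of a tableau of hook shape without its top entry. -/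
def lowerColumn {n l : ℕ} (T : Tableau (hook n l) n) (i : Fin l) : Fin n :=
  firstColumn T i.succ

open Classical in
/-- The polytabloid `⟨b⟩` of hook shape determined by the tuple `b` of entries in its first column
(see `hookPoly_eq`). It is zero if there is no tableau with first column `b`, that is, if `b` has
a repeated entry (see `exists_firstColumn_eq`). -/
noncomputable def hookPoly {n l : ℕ} (b : Fin (l + 1) → Fin n) : lattice (hook n l) n :=
  if h : ∃ T : Tableau (hook n l) n, firstColumn T = b then poly h.choose else 0

theorem firstColumn_injective {n l : ℕ} (T : Tableau (hook n l) n) :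
    Function.Injective (firstColumn T) := by
  intro i j h
  have := T.injective h
  simp only [Subtype.mk.injEq, Prod.mk.injEq, and_true] at this
  exact Fin.ext this

theorem colOf_eq_zero {n l : ℕ} (T : Tableau (hook n l) n) (e : Fin n) :
    T.colOf e = 0 ↔ e ∈ Set.range (firstColumn T) := by
  constructor
  · intro h
    have hm := mem_hook.1 (T.symm e).2
    have h' : (T.symm e).1.2 = 0 := h
    refine ⟨⟨(T.symm e).1.1, by omega⟩, ?_⟩
    unfold firstColumn
    rw [← T.eq_symm_apply]
    exact Subtype.ext (Prod.ext rfl h'.symm)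
  · rintro ⟨i, rfl⟩
    simp [Tableau.colOf, firstColumn]

theorem rowOf_eq {n l : ℕ} (T T' : Tableau (hook n l) n) (h : firstColumn T = firstColumn T')
    (e : Fin n) : T.rowOf e = T'.rowOf e := by
  by_cases he : e ∈ Set.range (firstColumn T)
  · obtain ⟨i, rfl⟩ := he
    have h1 : T.rowOf (firstColumn T i) = i := by simp [Tableau.rowOf, firstColumn]
    have h2 : T'.rowOf (firstColumn T' i) = i := by simp [Tableau.rowOf, firstColumn]
    rw [h1, h, h2]
  · have h1 : T.colOf e ≠ 0 := fun hh => he ((colOf_eq_zero T e).1 hh)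
    have h2 : T'.colOf e ≠ 0 := fun hh => he (h ▸ (colOf_eq_zero T' e).1 hh)
    have m1 := mem_hook.1 (T.symm e).2
    have m2 := mem_hook.1 (T'.symm e).2
    unfold Tableau.colOf at h1 h2
    unfold Tableau.rowOf
    omega

theorem colOf_comp_iff {n l : ℕ} (T : Tableau (hook n l) n) (σ : Equiv.Perm (Fin n)) :
    (∀ e, T.colOf (σ e) = T.colOf e) ↔ ∀ e, e ∉ Set.range (firstColumn T) → σ e = e := by
  constructor
  · intro h e he
    have h1 : T.colOf e ≠ 0 := fun hh => he ((colOf_eq_zero T e).1 hh)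
    have h2 := h e
    have m1 := mem_hook.1 (T.symm e).2
    have m2 := mem_hook.1 (T.symm (σ e)).2
    unfold Tableau.colOf at h1 h2
    apply T.symm.injective
    exact Subtype.ext (Prod.ext (by omega) h2)
  · intro h e
    by_cases he : e ∈ Set.range (firstColumn T)
    · rw [(colOf_eq_zero T e).2 he]
      rw [colOf_eq_zero]
      by_contra hc
      have := σ.injective (h _ hc)
      exact hc (this.symm ▸ he)
    · rw [h e he]

theorem polytabloid_eq_of_firstColumn_eq {n l : ℕ} (T T' : Tableau (hook n l) n)
    (h : firstColumn T = firstColumn T') : polytabloid T = polytabloid T' := by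
  unfold polytabloid
  refine Finset.sum_congr ?_ fun σ _ => ?_
  · ext σ
    simp only [Finset.mem_filter, Finset.mem_univ, true_and]
    rw [colOf_comp_iff, colOf_comp_iff, h]
  · have : (T.act σ).tabloid = (T'.act σ).tabloid :=
      Quotient.sound (s := rowSetoid _ _) fun e => rowOf_eq T T' h (σ.symm e)
    rw [this]

/-- A polytabloid of hook shape is determined by its first column. -/
theorem hookPoly_eq {n l : ℕ} (T : Tableau (hook n l) n) : hookPoly (firstColumn T) = poly T := by
  have h : ∃ T' : Tableau (hook n l) n, firstColumn T' = firstColumn T := ⟨T, rfl⟩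
  rw [hookPoly, dif_pos h]
  exact Subtype.ext (polytabloid_eq_of_firstColumn_eq _ _ h.choose_spec)

theorem nonempty_tableau_hook {n l : ℕ} (hl : l < n) : Nonempty (Tableau (hook n l) n) := by
  refine ⟨
    { toFun := fun c => ⟨if c.1.2 = 0 then c.1.1 else l + c.1.2, by
        have := mem_hook.1 c.2
        split_ifs <;> omega⟩
      invFun := fun k => ⟨(if (k : ℕ) ≤ l then (k : ℕ) else 0, (k : ℕ) - l), mem_hook.2 (by
        have := k.2
        dsimp only
        split_ifs <;> omega)⟩
      left_inv := ?_
      right_inv := ?_ }⟩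
  · rintro ⟨⟨a, b⟩, hc⟩
    have h := mem_hook.1 hc
    dsimp only at h
    refine Subtype.ext (Prod.ext ?_ ?_)
    · dsimp only
      split_ifs <;> omega
    · dsimp only
      split_ifs <;> omega
  · rintro ⟨k, hk⟩
    apply Fin.ext
    dsimp only
    split_ifs <;> omega

/-- Each tuple with pairwise distinct entries is the first column of a tableau of hook shape. -/
theorem exists_firstColumn_eq {n l : ℕ} (hl : l < n) (b : Fin (l + 1) → Fin n) :
    (∃ T : Tableau (hook n l) n, firstColumn T = b) ↔ Function.Injective b := by
  constructor
  · rintro ⟨T, rfl⟩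
    exact firstColumn_injective T
  · intro hb
    obtain ⟨e0⟩ := nonempty_tableau_hook hl
    have hs : ∀ i, firstColumn e0 i ∈ Set.range (firstColumn e0) := fun i => ⟨i, rfl⟩
    let f : Set.range (firstColumn e0) ≃ Set.range b :=
      (Equiv.ofInjective _ (firstColumn_injective e0)).symm.trans (Equiv.ofInjective _ hb)
    classical
    let σ : Equiv.Perm (Fin n) := f.extendSubtype
    refine ⟨e0.trans σ, funext fun i => ?_⟩
    change σ (firstColumn e0 i) = b i
    have h1 := f.extendSubtype_apply_of_mem (firstColumn e0 i) (hs i)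
    refine h1.trans ?_
    change ((Equiv.ofInjective _ hb)
      ((Equiv.ofInjective _ (firstColumn_injective e0)).symm ⟨firstColumn e0 i, hs i⟩)).1 = b i
    rw [show (⟨firstColumn e0 i, hs i⟩ : Set.range (firstColumn e0)) =
      Equiv.ofInjective _ (firstColumn_injective e0) i from rfl, Equiv.symm_apply_apply]
    rfl

/-- The standard tableaux of hook shape. -/
abbrev StandardHook (n l : ℕ) : Type := {T : Tableau (hook n l) n // T.IsStandard}

/-- The largest entry `n`. -/
def top {n : ℕ} (hn : 2 ≤ n) : Fin n := ⟨n - 1, by omega⟩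

/-- The entry `n` occurs in the first column of `T`. -/
def TopInColumn {n l : ℕ} (hn : 2 ≤ n) (T : StandardHook n l) : Prop :=
  top hn ∈ Set.range (firstColumn T.1)

/-- The element of the standard basis attached to a standard tableau `T`. -/
noncomputable def yElt {n l : ℕ} (T : StandardHook n l) : lattice (hook n l) n := poly T.1

open Classical in
/-- The element of the first basis whose diagonal correspondent is `⟨1, c⟩ = yElt T`, where `(1, c)`
is the first column of the standard tableau `T`. If `n` does not occur in `c`, it is `⟨n, c⟩`.
If `c = (d, n)`, it is the sum of the `⟨s, d, n⟩ = ⟨s, c⟩` over the elements `s` of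
`[1, n - 1]` not in `d`, that is, over the entries `s` that do not occur in `c`. -/
noncomputable def xElt {n l : ℕ} (hn : 2 ≤ n) (T : StandardHook n l) : lattice (hook n l) n :=
  if TopInColumn hn T then
    ∑ s : Fin n with s ∉ Set.range (lowerColumn T.1),
      hookPoly (Fin.cons s (lowerColumn T.1) : Fin (l + 1) → Fin n)
  else hookPoly (Fin.cons (top hn) (lowerColumn T.1) : Fin (l + 1) → Fin n)

end Specht

namespace Specht

variable {n l : ℕ}

/-! A hook tabloid is determined by its entries below the first row, so `M^λ` embeds isometrically
into functions on `l`-tuples, with the standard scalar product. The value of `⟨b⟩` at `t` is the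
determinant of the incidence matrix of `b` and `t` bordered by a column of ones. Laplace expansion
along that column writes `⟨b⟩` as the simplicial boundary of `b`. Every `v` in the lattice is
therefore alternating (`value_comp_perm`) and has zero sum over its first argument
(`sum_value_cons`).

Pairing an alternating function with one face of `b` gives `l!` times its value there, so `(⟨b⟩, v)`
is `l!` times the alternating sum of the values of `v` at the faces of `b` (`form_hookPoly`).
Summing over `b = (s, c)` for all `s` leaves only the face `c`, giving `n * l! * v(c)`
(`form_sum_hookPoly_cons`). As `1` lies in no lower column of a standard tableau, the standard
polytabloids are dual to evaluation at these columns (`value_lowerColumn_yElt`). This makes the Gram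
matrix of `x` and `y` block triangular, with diagonal blocks `l!` and `n * l!` and an off-diagonal
block divisible by `l!`.

Straightening with respect to `1` shows that `y` spans, and with respect to `n` that `x` does. Then
the cokernel is read off by clearing the off-diagonal block. -/

/-! ### Coordinates on the tabloid module -/

theorem rowOf_lowerColumn (T : Tableau (hook n l) n) (i : Fin l) :
    T.rowOf (lowerColumn T i) = i + 1 := by
  simp [Tableau.rowOf, lowerColumn, firstColumn]

theorem lowerColumn_eq_of_rowOf (T : Tableau (hook n l) n) (i : Fin l) (e : Fin n)
    (h : T.rowOf e = i + 1) : lowerColumn T i = e := by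
  have m := mem_hook.1 (T.symm e).2
  unfold Tableau.rowOf at h
  unfold lowerColumn firstColumn
  rw [← T.eq_symm_apply]
  refine Subtype.ext (Prod.ext ?_ ?_)
  · simp [h]
  · change 0 = _
    omega

theorem rowOf_le (T : Tableau (hook n l) n) (e : Fin n) : T.rowOf e ≤ l := by
  have m := mem_hook.1 (T.symm e).2
  unfold Tableau.rowOf
  omega

/-- The entries of a tabloid of hook shape in the rows below the first one. -/
def Tabloid.lower : Tabloid (hook n l) n → Fin l → Fin n :=
  Quotient.lift lowerColumn fun T T' h => funext fun i =>
    (lowerColumn_eq_of_rowOf T' i _ ((h _).symm.trans (rowOf_lowerColumn T i))).symm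

/-- Below the first row each row has one cell, and the first row holds whatever entries remain. -/
theorem lower_injective : Function.Injective (Tabloid.lower (n := n) (l := l)) := by
  intro s t
  induction s using Quotient.inductionOn with | _ T
  induction t using Quotient.inductionOn with | _ T'
  intro h
  have h : lowerColumn T = lowerColumn T' := h
  refine Quotient.sound fun e => ?_
  rcases Nat.eq_zero_or_pos (T.rowOf e) with h0 | h0
  · rcases Nat.eq_zero_or_pos (T'.rowOf e) with h1 | h1
    · rw [h0, h1]
    · have hle := rowOf_le T' e
      have := lowerColumn_eq_of_rowOf T' ⟨T'.rowOf e - 1, by omega⟩ e (by simp; omega)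
      rw [← h] at this
      have h2 := rowOf_lowerColumn T ⟨T'.rowOf e - 1, by omega⟩
      rw [this] at h2
      simp at h2
      omega
  · have hle := rowOf_le T e
    have := lowerColumn_eq_of_rowOf T ⟨T.rowOf e - 1, by omega⟩ e (by simp; omega)
    rw [h] at this
    have h2 := rowOf_lowerColumn T' ⟨T.rowOf e - 1, by omega⟩
    rw [this] at h2
    simp at h2
    omega

/-- The coordinates of an element of `M^μ`, indexed by the lower columns of tabloids. -/
noncomputable def coords (n l : ℕ) :
    TabloidModule (hook n l) n →ₗ[ℤ] ((Fin l → Fin n) →₀ ℤ) :=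
  Finsupp.lmapDomain ℤ ℤ Tabloid.lower

theorem coords_injective : Function.Injective (coords n l) :=
  Finsupp.mapDomain_injective lower_injective

theorem coords_single (s : Tabloid (hook n l) n) (a : ℤ) :
    coords n l (Finsupp.single s a) = Finsupp.single s.lower a := by
  simp [coords]

theorem tabloidForm_eq_sum (u v : TabloidModule (hook n l) n) :
    tabloidForm (hook n l) n u v = ∑ t, coords n l u t * coords n l v t := by
  classical
  induction u using Finsupp.induction_linear with
  | zero => simp
  | add u u' h h' => simp [h, h', add_mul, Finset.sum_add_distrib]
  | single s a =>
    induction v using Finsupp.induction_linear with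
    | zero => simp
    | add v v' h h' => simp only [map_add, h, h', Finsupp.add_apply, mul_add, Finset.sum_add_distrib]
    | single t b =>
      simp [coords_single, tabloidForm, Finsupp.single_apply, lower_injective.eq_iff, eq_comm]

/-- The coordinate at `t` on the Specht lattice. -/
noncomputable def value (t : Fin l → Fin n) : lattice (hook n l) n →ₗ[ℤ] ℤ :=
  Finsupp.lapply t ∘ₗ coords n l ∘ₗ (lattice (hook n l) n).subtype

theorem ext_value {u v : lattice (hook n l) n} (h : ∀ t, value t u = value t v) : u = v :=
  Subtype.ext (coords_injective (Finsupp.ext h))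

theorem form_eq_sum (u v : lattice (hook n l) n) :
    form (hook n l) n u v = ∑ t, value t u * value t v :=
  tabloidForm_eq_sum _ _

/-! ### Polytabloids as determinants -/

/-- The determinant of the incidence matrix of two tuples. -/
def minor {k : ℕ} (c t : Fin k → Fin n) : ℤ :=
  (Matrix.of fun r j => if c r = t j then (1 : ℤ) else 0).det

/-- The incidence matrix of two tuples, with a column of ones in front. -/
def borderedIncidence (b : Fin (l + 1) → Fin n) (t : Fin l → Fin n) :
    Matrix (Fin (l + 1)) (Fin (l + 1)) ℤ :=
  Matrix.of fun i => Fin.cons 1 fun j => if b i = t j then 1 else 0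

/-- The coordinate of the polytabloid with first column `b` at `t`. -/
def coef (b : Fin (l + 1) → Fin n) (t : Fin l → Fin n) : ℤ := (borderedIncidence b t).det

/-- In the Leibniz formula the column of ones imposes no condition on `b (π 0)`, the entry that
moves to the first row. -/
theorem coef_eq_sum_perm (b : Fin (l + 1) → Fin n) (t : Fin l → Fin n) :
    coef b t = ∑ π : Equiv.Perm (Fin (l + 1)),
      (Equiv.Perm.sign π : ℤ) * if (fun j : Fin l => b (π j.succ)) = t then 1 else 0 := by
  classical
  rw [coef, Matrix.det_apply']
  refine Finset.sum_congr rfl fun π _ => ?_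
  rw [Fin.prod_univ_succ]
  simp [borderedIncidence, Finset.prod_ite_zero, funext_iff]

theorem coef_eq_sum (b : Fin (l + 1) → Fin n) (t : Fin l → Fin n) :
    coef b t = ∑ i : Fin (l + 1), (-1) ^ (i : ℕ) * minor (b ∘ i.succAbove) t := by
  rw [coef, Matrix.det_succ_column_zero]
  refine Finset.sum_congr rfl fun i _ => ?_
  simp only [borderedIncidence, Matrix.of_apply, Fin.cons_zero, mul_one]
  rfl

theorem value_poly (T : Tableau (hook n l) n) (t : Fin l → Fin n) :
    value t (poly T) = coef (firstColumn T) t := by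
  classical
  have h1 : value t (poly T) = ∑ σ : Equiv.Perm (Fin n) with ∀ e, T.colOf (σ e) = T.colOf e,
      (Equiv.Perm.sign σ : ℤ) * if (fun j => σ (lowerColumn T j)) = t then 1 else 0 := by
    change coords n l (polytabloid T) t = _
    rw [polytabloid, map_sum, Finsupp.finsetSum_apply]
    refine Finset.sum_congr rfl fun σ _ => ?_
    rw [map_smul, coords_single, Finsupp.smul_apply, Finsupp.single_apply, smul_eq_mul]
    rfl
  rw [h1, coef_eq_sum_perm]
  let f : Fin (l + 1) ≃ {e // e ∈ Set.range (firstColumn T)} :=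
    Equiv.ofInjective _ (firstColumn_injective T)
  have hf : ∀ i, (f i : Fin n) = firstColumn T i := fun i => rfl
  -- The column stabilizer is the symmetric group on the positions of the first column, extended by
  -- the identity. This preserves signs.
  let E : Equiv.Perm (Fin (l + 1)) ≃
      {σ : Equiv.Perm (Fin n) // ∀ e, e ∉ Set.range (firstColumn T) → σ e = e} :=
    (Equiv.permCongr f).trans (Equiv.Perm.subtypeEquivSubtypePerm _)
  have hE : ∀ π, (E π : Equiv.Perm (Fin n)) = Equiv.Perm.ofSubtype (Equiv.permCongr f π) :=
    fun π => rfl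
  have hE' : ∀ π i, (E π : Equiv.Perm (Fin n)) (firstColumn T i) = firstColumn T (π i) := by
    intro π i
    rw [hE, ← hf i, Equiv.Perm.ofSubtype_apply_coe]
    simp [Equiv.permCongr_apply, hf]
  symm
  refine Finset.sum_bij (fun π _ => (E π : Equiv.Perm (Fin n))) ?_ ?_ ?_ ?_
  · intro π _
    simp only [Finset.mem_filter, Finset.mem_univ, true_and]
    rw [colOf_comp_iff]
    exact (E π).2
  · intro π _ π' _ h
    exact E.injective (Subtype.ext h)
  · intro σ hσ
    simp only [Finset.mem_filter, Finset.mem_univ, true_and] at hσ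
    rw [colOf_comp_iff] at hσ
    exact ⟨E.symm ⟨σ, hσ⟩, Finset.mem_univ _, by simp⟩
  · intro π _
    simp only [lowerColumn, hE']
    rw [hE, Equiv.Perm.sign_ofSubtype, Equiv.Perm.sign_permCongr]

theorem coef_eq_zero_of_not_injective (b : Fin (l + 1) → Fin n) (hb : ¬ Function.Injective b)
    (t : Fin l → Fin n) : coef b t = 0 := by
  simp only [Function.Injective, not_forall] at hb
  obtain ⟨i, j, h, hij⟩ := hb
  exact Matrix.det_zero_of_row_eq hij (funext fun k => by simp [borderedIncidence, h])

theorem value_hookPoly (hl : l < n) (b : Fin (l + 1) → Fin n) (t : Fin l → Fin n) :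
    value t (hookPoly b) = coef b t := by
  by_cases h : ∃ T : Tableau (hook n l) n, firstColumn T = b
  · obtain ⟨T, rfl⟩ := h
    rw [hookPoly_eq, value_poly]
  · rw [hookPoly, dif_neg h, map_zero, coef_eq_zero_of_not_injective]
    rwa [exists_firstColumn_eq hl] at h

/-- Induction on elements of the Specht lattice. -/
theorem lattice_induction {p : lattice (hook n l) n → Prop} (v : lattice (hook n l) n)
    (poly : ∀ T, p (poly T)) (zero : p 0) (add : ∀ u v, p u → p v → p (u + v))
    (smul : ∀ (a : ℤ) u, p u → p (a • u)) : p v := by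
  obtain ⟨v, hv⟩ := v
  induction hv using Submodule.span_induction with
  | mem x h =>
    obtain ⟨T, rfl⟩ := h
    exact poly T
  | zero => exact zero
  | add x y hx hy h h' => exact add _ _ h h'
  | smul a x hx h => exact smul a _ h

/-! ### Alternating values and the bilinear form -/

theorem minor_comp_perm_right {k : ℕ} (c t : Fin k → Fin n) (π : Equiv.Perm (Fin k)) :
    minor c (t ∘ π) = Equiv.Perm.sign π * minor c t :=
  Matrix.det_permute' π (Matrix.of fun r j => if c r = t j then (1 : ℤ) else 0)

theorem value_comp_perm (v : lattice (hook n l) n) (t : Fin l → Fin n)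
    (π : Equiv.Perm (Fin l)) : value (t ∘ π) v = Equiv.Perm.sign π * value t v := by
  induction v using lattice_induction with
  | poly T =>
    simp only [value_poly, coef_eq_sum, minor_comp_perm_right, Finset.mul_sum]
    exact Finset.sum_congr rfl fun i _ => by ring
  | zero => simp
  | add u v hu hv => rw [map_add, hu, hv, map_add, mul_add]
  | smul a u hu => rw [map_smul, hu, map_smul, smul_eq_mul, smul_eq_mul]; ring

/-- `minor c` is the signed sum of the indicators of the rearrangements `c ∘ π`. Since `g` is
alternating, each of the `k!` permutations contributes `g c`. -/
theorem sum_minor_mul {k : ℕ} (c : Fin k → Fin n) (g : (Fin k → Fin n) → ℤ)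
    (hg : ∀ t (π : Equiv.Perm (Fin k)), g (t ∘ π) = Equiv.Perm.sign π * g t) :
    ∑ t, minor c t * g t = (k ! : ℤ) * g c := by
  classical
  have h : ∀ t, minor c t = ∑ π : Equiv.Perm (Fin k),
      (Equiv.Perm.sign π : ℤ) * if c ∘ π = t then 1 else 0 := by
    intro t
    rw [minor, Matrix.det_apply']
    refine Finset.sum_congr rfl fun π _ => ?_
    simp [Finset.prod_ite_zero, funext_iff]
  simp only [h, Finset.sum_mul]
  rw [Finset.sum_comm]
  have h2 : ∀ π : Equiv.Perm (Fin k), ∑ t, ((Equiv.Perm.sign π : ℤ) *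
      if c ∘ π = t then 1 else 0) * g t = g c := by
    intro π
    simp only [mul_ite, mul_one, mul_zero, ite_mul, zero_mul, Finset.sum_ite_eq,
      Finset.mem_univ, if_true]
    rw [hg, ← mul_assoc, ← Units.val_mul, Int.units_mul_self]
    simp
  rw [Finset.sum_congr rfl fun π _ => h2 π]
  simp [Fintype.card_perm]

theorem form_hookPoly (hl : l < n) (b : Fin (l + 1) → Fin n) (v : lattice (hook n l) n) :
    form (hook n l) n (hookPoly b) v =
      (l ! : ℤ) * ∑ i : Fin (l + 1), (-1) ^ (i : ℕ) * value (b ∘ i.succAbove) v := by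
  simp only [form_eq_sum, value_hookPoly hl, coef_eq_sum, Finset.sum_mul]
  rw [Finset.sum_comm, Finset.mul_sum]
  refine Finset.sum_congr rfl fun i _ => ?_
  simp only [mul_assoc]
  rw [← Finset.mul_sum, sum_minor_mul _ (fun t => value t v) fun t π => value_comp_perm v t π]
  ring

/-- The column belonging to `s` is an indicator vector. Each `b i` equals exactly one `s`, so the
sum over `s` turns it into a second column of ones. -/
theorem sum_coef_cons {k : ℕ} (b : Fin (k + 1 + 1) → Fin n) (d : Fin k → Fin n) :
    ∑ s, coef b (Fin.cons s d) = 0 := by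
  have h : ∀ s, coef b (Fin.cons s d) = Matrix.detRowAlternating
      (Function.update (fun j i => borderedIncidence b (Fin.cons (b 0) d) i j) 1
        fun i => if b i = s then 1 else 0) := by
    intro s
    rw [coef, ← Matrix.det_transpose]
    congr 1
    ext j i
    refine Fin.cases ?_ (fun j => ?_) j
    · simp [borderedIncidence]
    · refine Fin.cases ?_ (fun j => ?_) j
      · simp [borderedIncidence]
      · rw [Function.update_of_ne (by simp [Fin.ext_iff])]
        simp [borderedIncidence]
  simp only [h]
  rw [← AlternatingMap.map_update_sum]
  refine AlternatingMap.map_eq_zero_of_eq _ _ (i := 0) (j := 1) ?_ (by simp)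
  rw [Function.update_self, Function.update_of_ne (by simp)]
  ext i
  simp [borderedIncidence]

theorem sum_value_cons {k : ℕ} (v : lattice (hook n (k + 1)) n) (d : Fin k → Fin n) :
    ∑ s, value (Fin.cons s d) v = 0 := by
  induction v using lattice_induction with
  | poly T => simp only [value_poly, sum_coef_cons]
  | zero => simp
  | add u v hu hv => simp only [map_add, Finset.sum_add_distrib, hu, hv, add_zero]
  | smul a u hu => simp only [map_smul, ← Finset.smul_sum, hu, smul_zero]

theorem cons_comp_succAbove_zero (s : Fin n) (c : Fin l → Fin n) :
    (Fin.cons s c : Fin (l + 1) → Fin n) ∘ (0 : Fin (l + 1)).succAbove = c := by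
  ext; simp

theorem cons_comp_succAbove_succ (s : Fin n) (c : Fin (l + 1) → Fin n) (i : Fin (l + 1)) :
    (Fin.cons s c : Fin (l + 1 + 1) → Fin n) ∘ i.succ.succAbove =
      Fin.cons s (c ∘ i.succAbove) := by
  ext j
  refine Fin.cases ?_ (fun j => ?_) j <;> simp

/-- The face omitting `s` is `c` for each of the `n` choices of `s`. Every other face begins with
`s`, and its values sum to zero over `s`. -/
theorem form_sum_hookPoly_cons (hl : l < n) (c : Fin l → Fin n) (v : lattice (hook n l) n) :
    form (hook n l) n (∑ s, hookPoly (Fin.cons s c)) v = (n * l ! : ℤ) * value c v := by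
  simp only [map_sum, LinearMap.sum_apply, form_hookPoly hl]
  rw [← Finset.mul_sum]
  simp only [Fin.sum_univ_succ (n := l), cons_comp_succAbove_zero]
  rw [Finset.sum_add_distrib, Finset.sum_comm]
  have h : ∀ i : Fin l, ∑ s : Fin n, (-1 : ℤ) ^ (i.succ : ℕ) *
      value ((Fin.cons s c : Fin (l + 1) → Fin n) ∘ i.succ.succAbove) v = 0 := by
    intro i
    obtain _ | l := l
    · exact i.elim0
    · simp only [cons_comp_succAbove_succ]
      rw [← Finset.mul_sum, sum_value_cons, mul_zero]
  rw [Finset.sum_eq_zero fun i _ => h i]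
  simp
  ring

/-! ### Straightening and permutation of the first column -/

/-- Straightening with respect to a fixed entry `a`. -/
theorem hookPoly_eq_sum (hl : l < n) (a : Fin n) (b : Fin (l + 1) → Fin n) :
    hookPoly b = ∑ i : Fin (l + 1), (-1 : ℤ) ^ (i : ℕ) •
      hookPoly (Fin.cons a (b ∘ i.succAbove)) := by
  refine ext_value fun t => ?_
  simp only [map_sum, map_smul, value_hookPoly hl, smul_eq_mul]
  -- Two equal columns of ones make the determinant vanish; expanding along one of them gives the
  -- relation that the alternating sum of the faces of `(a, b)` is zero.
  let A : Matrix (Fin (l + 1 + 1)) (Fin (l + 1 + 1)) ℤ :=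
    Matrix.of fun i => Fin.cons 1 (Fin.cons 1 fun j =>
      if (Fin.cons a b : Fin (l + 1 + 1) → Fin n) i = t j then 1 else 0)
  have h0 : A.det = 0 :=
    Matrix.det_zero_of_column_eq (i := 0) (j := 1) (by simp) fun i => by simp [A]
  have h1 : A.det = ∑ i : Fin (l + 1 + 1), (-1) ^ (i : ℕ) *
      coef ((Fin.cons a b : Fin (l + 1 + 1) → Fin n) ∘ i.succAbove) t := by
    rw [Matrix.det_succ_column_zero]
    refine Finset.sum_congr rfl fun i _ => ?_
    simp only [A, Matrix.of_apply, Fin.cons_zero, mul_one]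
    rfl
  rw [h0, Fin.sum_univ_succ, cons_comp_succAbove_zero] at h1
  simp only [cons_comp_succAbove_succ, Fin.val_succ, pow_succ, Fin.val_zero, pow_zero, one_mul,
    mul_neg, mul_one, neg_mul, Finset.sum_neg_distrib] at h1
  linarith

theorem hookPoly_comp_perm (hl : l < n) (b : Fin (l + 1) → Fin n)
    (π : Equiv.Perm (Fin (l + 1))) :
    hookPoly (b ∘ π) = (Equiv.Perm.sign π : ℤ) • hookPoly b := by
  refine ext_value fun t => ?_
  simp only [map_smul, value_hookPoly hl, smul_eq_mul]
  exact Matrix.det_permute π (borderedIncidence b t)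

/-! ### Standard hook tableaux and their number -/

/-- The smallest entry `1`. -/
def first (hn : 2 ≤ n) : Fin n := ⟨0, by omega⟩

theorem first_ne_top (hn : 2 ≤ n) : first hn ≠ top hn := by
  simp only [first, top, ne_eq, Fin.mk.injEq]
  omega

theorem firstColumn_eq_cons (T : Tableau (hook n l) n) :
    firstColumn T = Fin.cons (firstColumn T 0) (lowerColumn T) := by
  ext i
  refine Fin.cases ?_ (fun i => ?_) i <;> simp [lowerColumn]

theorem strictMono_firstColumn (T : StandardHook n l) : StrictMono (firstColumn T.1) :=
  fun _ _ h => T.2 _ _ (Or.inr ⟨rfl, h⟩)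

theorem strictMono_lowerColumn (T : StandardHook n l) : StrictMono (lowerColumn T.1) :=
  fun _ _ h => strictMono_firstColumn T (Fin.succ_lt_succ_iff.2 h)

theorem firstColumn_zero (hn : 2 ≤ n) (T : StandardHook n l) :
    firstColumn T.1 0 = first hn := by
  obtain ⟨⟨⟨i, j⟩, hc⟩, h⟩ := T.1.surjective (first hn)
  have m := mem_hook.1 hc
  dsimp only at m
  by_cases h0 : i = 0 ∧ j = 0
  · obtain ⟨rfl, rfl⟩ := h0
    exact h
  · have hlt : firstColumn T.1 0 < T.1 ⟨(i, j), hc⟩ := T.2 _ _ (by simp; omega)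
    rw [h] at hlt
    exact absurd hlt (Nat.not_lt_zero _)

theorem first_lt_lowerColumn (hn : 2 ≤ n) (T : StandardHook n l) (i : Fin l) :
    first hn < lowerColumn T.1 i := by
  rw [← firstColumn_zero hn T]
  exact strictMono_firstColumn T (Fin.succ_pos i)

theorem firstColumn_eq (hn : 2 ≤ n) (T : StandardHook n l) :
    firstColumn T.1 = Fin.cons (first hn) (lowerColumn T.1) := by
  rw [firstColumn_eq_cons, firstColumn_zero hn]

theorem topInColumn_iff (hn : 2 ≤ n) (T : StandardHook n l) :
    TopInColumn hn T ↔ top hn ∈ Set.range (lowerColumn T.1) := by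
  rw [TopInColumn, firstColumn_eq hn, Fin.range_cons, Set.mem_insert_iff,
    or_iff_right (first_ne_top hn).symm]

/-- The cells of a hook, split into the first column and the rest of the first row. -/
def hookCells (hl : l < n) :
    {c : ℕ × ℕ // c ∈ hook n l} ≃ Fin (l + 1) ⊕ Fin (n - (l + 1)) where
  toFun c := if h : c.1.2 = 0 then .inl ⟨c.1.1, by have := mem_hook.1 c.2; omega⟩
    else .inr ⟨c.1.2 - 1, by have := mem_hook.1 c.2; omega⟩
  invFun := Sum.elim (fun i => ⟨(i, 0), mem_hook.2 (Or.inl ⟨i.2, rfl⟩)⟩)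
    fun j => ⟨(0, j + 1), mem_hook.2 (Or.inr ⟨rfl, by dsimp only; omega⟩)⟩
  left_inv := by
    rintro ⟨⟨i, j⟩, hc⟩
    have m := mem_hook.1 hc
    dsimp only at m
    by_cases h : j = 0
    · simp [h]
    · simp only [h, dite_false, Sum.elim_inr, Subtype.mk.injEq, Prod.mk.injEq]
      omega
  right_inv := by
    rintro (i | j) <;> simp

theorem card_compl_firstColumn (T : Tableau (hook n l) n) :
    (Finset.univ.image (firstColumn T))ᶜ.card = n - (l + 1) := by
  rw [Finset.card_compl, Finset.card_image_of_injective _ (firstColumn_injective T)]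
  simp

/-- Beyond the corner, the first row must list the complement of the first column in increasing
order, so the first column determines a standard tableau. -/
theorem symm_hookCells_eq (hl : l < n) (T : StandardHook n l) :
    (fun j => T.1 ((hookCells hl).symm (.inr j))) =
      (Finset.univ.image (firstColumn T.1))ᶜ.orderEmbOfFin (card_compl_firstColumn T.1) := by
  refine Finset.orderEmbOfFin_unique _ (fun j => ?_) fun i j hij => ?_
  · simp only [Finset.mem_compl, Finset.mem_image, Finset.mem_univ, true_and, not_exists]
    intro i h
    have := T.1.injective h
    simp [hookCells] at this
  · refine T.2 _ _ (Or.inl ⟨rfl, ?_⟩)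
    exact Nat.succ_lt_succ hij

theorem standard_ext (hn : 2 ≤ n) (hl : l < n) {T T' : StandardHook n l}
    (h : lowerColumn T.1 = lowerColumn T'.1) : T = T' := by
  have hf : firstColumn T.1 = firstColumn T'.1 := by rw [firstColumn_eq hn, firstColumn_eq hn, h]
  refine Subtype.ext (Equiv.ext fun c => ?_)
  rw [← (hookCells hl).symm_apply_apply c]
  rcases hookCells hl c with i | j
  · exact congrFun hf i
  · have h1 := congrFun (symm_hookCells_eq hl T) j
    have h2 := congrFun (symm_hookCells_eq hl T') j
    rw [h1, h2]
    simp only [hf]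

theorem exists_standard (hn : 2 ≤ n) (hl : l < n) (c : Fin l → Fin n) (hc : StrictMono c)
    (h0 : ∀ i, first hn < c i) : ∃ T : StandardHook n l, lowerColumn T.1 = c := by
  have hb : StrictMono (Fin.cons (first hn) c : Fin (l + 1) → Fin n) :=
    Fin.strictMono_cons.2 ⟨h0, hc⟩
  set b : Fin (l + 1) → Fin n := Fin.cons (first hn) c with hb'
  have hm : (Finset.univ.image b).card = l + 1 := by
    rw [Finset.card_image_of_injective _ hb.injective, Finset.card_univ, Fintype.card_fin]
  have hm' : (Finset.univ.image b)ᶜ.card = n - (l + 1) := by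
    rw [Finset.card_compl, hm, Fintype.card_fin]
  have hs : b = (Finset.univ.image b).orderEmbOfFin hm :=
    Finset.orderEmbOfFin_unique _ (fun i => Finset.mem_image_of_mem _ (Finset.mem_univ _)) hb
  let T : Tableau (hook n l) n := (hookCells hl).trans (finSumEquivOfFinset hm hm')
  have hcol : ∀ (i : ℕ) (h : (i, 0) ∈ hook n l) (hi : i < l + 1),
      T ⟨(i, 0), h⟩ = b ⟨i, hi⟩ := by
    intro i h hi
    rw [hs]
    simp [T, hookCells]
  have hrow : ∀ (j : ℕ) (h : (0, j + 1) ∈ hook n l) (hj : j < n - (l + 1)),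
      T ⟨(0, j + 1), h⟩ = (Finset.univ.image b)ᶜ.orderEmbOfFin hm' ⟨j, hj⟩ := by
    intro j h hj
    simp [T, hookCells]
  refine ⟨⟨T, ?_⟩, ?_⟩
  · rintro ⟨⟨i, j⟩, hc⟩ ⟨⟨i', j'⟩, hd⟩ h
    have m := mem_hook.1 hc
    have m' := mem_hook.1 hd
    dsimp only at m m' h
    rcases h with ⟨rfl, h⟩ | ⟨rfl, h⟩
    · obtain rfl : i = 0 := by omega
      obtain ⟨j', rfl⟩ : ∃ k, j' = k + 1 := ⟨j' - 1, by omega⟩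
      rw [hrow j' hd (by omega)]
      obtain _ | j := j
      · rw [hcol 0 hc (by omega)]
        -- The corner holds the least entry, so it suffices that the entry to its right, taken from
        -- the complement, differs from it.
        have hne := Finset.mem_compl.1
          (Finset.orderEmbOfFin_mem (Finset.univ.image b)ᶜ hm' ⟨j', by omega⟩)
        refine lt_of_le_of_ne (Nat.zero_le _) fun he => hne ?_
        rw [← he]
        exact Finset.mem_image_of_mem _ (Finset.mem_univ _)
      · rw [hrow j hc (by omega)]
        exact (OrderEmbedding.lt_iff_lt _).2 (Nat.lt_of_succ_lt_succ h)
    · obtain rfl : j = 0 := by omega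
      rw [hcol i hc (by omega), hcol i' hd (by omega)]
      exact hb h
  · ext i
    exact congrArg Fin.val (hcol (i + 1) _ (Nat.succ_lt_succ i.2))

/-- The set of entries below the corner. -/
def lowerSet (T : StandardHook n l) : Finset (Fin n) := Finset.univ.image (lowerColumn T.1)

/-- Taking the entries below the corner identifies the standard tableaux with the `l`-subsets of
`[2, n]`. -/
theorem card_subtype_lowerSet (hn : 2 ≤ n) (hl : l < n) (P : Finset (Fin n) → Prop)
    [DecidablePred P] : Nat.card {T : StandardHook n l // P (lowerSet T)} =
      ((Finset.powersetCard l (Finset.univ.erase (first hn))).filter P).card := by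
  rw [← Fintype.card_coe, ← Nat.card_eq_fintype_card]
  have hm : ∀ T : StandardHook n l, lowerSet T ∈ Finset.powersetCard l
      (Finset.univ.erase (first hn)) := by
    intro T
    rw [Finset.mem_powersetCard, lowerSet,
      Finset.card_image_of_injective _ (strictMono_lowerColumn T).injective]
    refine ⟨fun e he => ?_, by simp⟩
    obtain ⟨i, -, rfl⟩ := Finset.mem_image.1 he
    exact Finset.mem_erase.2 ⟨(first_lt_lowerColumn hn T i).ne', Finset.mem_univ _⟩
  refine Nat.card_congr (Equiv.ofBijective
    (fun T => ⟨lowerSet T.1, Finset.mem_filter.2 ⟨hm T.1, T.2⟩⟩) ⟨?_, ?_⟩)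
  · intro T T' h
    have h : lowerSet T.1 = lowerSet T'.1 := congrArg Subtype.val h
    refine Subtype.ext (standard_ext hn hl ?_)
    rw [← (strictMono_lowerColumn T.1).range_inj (strictMono_lowerColumn T'.1)]
    have := congrArg (fun s : Finset (Fin n) => (s : Set (Fin n))) h
    simpa [lowerSet] using this
  · rintro ⟨s, hs⟩
    obtain ⟨hs, hP⟩ := Finset.mem_filter.1 hs
    obtain ⟨hs, hcard⟩ := Finset.mem_powersetCard.1 hs
    obtain ⟨T, hT⟩ := exists_standard hn hl (s.orderEmbOfFin hcard)
      (s.orderEmbOfFin hcard).strictMono fun i => by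
        have := Finset.ne_of_mem_erase (hs (s.orderEmbOfFin_mem hcard i))
        exact lt_of_le_of_ne (Nat.zero_le _) this.symm
    have : lowerSet T = s := by rw [lowerSet, hT, Finset.image_orderEmbOfFin_univ]
    exact ⟨⟨T, this.symm ▸ hP⟩, Subtype.ext this⟩

theorem topInColumn_iff_mem_lowerSet (hn : 2 ≤ n) (T : StandardHook n l) :
    TopInColumn hn T ↔ top hn ∈ lowerSet T := by
  simp [topInColumn_iff, lowerSet]

theorem filter_top_notMem (hn : 2 ≤ n) (l : ℕ) :
    ((Finset.powersetCard l (Finset.univ.erase (first hn))).filter (top hn ∉ ·)).card =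
      (n - 2).choose l := by
  have : (Finset.powersetCard l (Finset.univ.erase (first hn))).filter (top hn ∉ ·) =
      Finset.powersetCard l ((Finset.univ.erase (first hn)).erase (top hn)) := by
    ext s
    simp only [Finset.mem_filter, Finset.mem_powersetCard, Finset.subset_erase]
    tauto
  rw [this, Finset.card_powersetCard, Finset.card_erase_of_mem, Finset.card_erase_of_mem]
  · simp [Nat.sub_sub]
  · simp
  · simp [(first_ne_top hn).symm]

theorem card_not_topInColumn (hn : 2 ≤ n) (hl : l < n) :
    Nat.card {T : StandardHook n l // ¬ TopInColumn hn T} = (n - 2).choose l := by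
  simp only [topInColumn_iff_mem_lowerSet]
  rw [card_subtype_lowerSet hn hl (top hn ∉ ·), filter_top_notMem]

theorem card_topInColumn (hn : 2 ≤ n) (hl : l < n) :
    Nat.card {T : StandardHook n l // TopInColumn hn T} =
      if l = 0 then 0 else (n - 2).choose (l - 1) := by
  simp only [topInColumn_iff_mem_lowerSet]
  rw [card_subtype_lowerSet hn hl (top hn ∈ ·)]
  obtain _ | k := l
  · simp
  -- Pascal's rule: of the `(n - 1).choose (k + 1)` subsets, those without `n` are already counted.
  · have h := Finset.card_filter_add_card_filter_not
      (s := Finset.powersetCard (k + 1) (Finset.univ.erase (first hn))) (top hn ∈ ·)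
    rw [filter_top_notMem, Finset.card_powersetCard, Finset.card_erase_of_mem (Finset.mem_univ _),
      Finset.card_univ, Fintype.card_fin, show n - 1 = n - 2 + 1 by omega,
      Nat.choose_succ_succ, Nat.succ_eq_add_one] at h
    simp only [Nat.add_eq_zero_iff, one_ne_zero, and_false, if_false, Nat.add_sub_cancel]
    omega

instance : Finite (StandardHook n l) := by
  have : Finite {c : ℕ × ℕ // c ∈ hook n l} := (hook n l).cells.finite_toSet
  infer_instance

theorem exists_sum_equiv (hn : 2 ≤ n) (hl : l < n) :
    ∃ T : Fin ((n - 2).choose l) ⊕ Fin (if l = 0 then 0 else (n - 2).choose (l - 1)) ≃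
      StandardHook n l, (∀ i, ¬ TopInColumn hn (T (.inl i))) ∧
        ∀ i, TopInColumn hn (T (.inr i)) := by
  classical
  let e1 := (Finite.equivFinOfCardEq (card_not_topInColumn hn hl)).symm
  let e2 := (Finite.equivFinOfCardEq (card_topInColumn hn hl)).symm
  refine ⟨(Equiv.sumComm _ _).trans ((Equiv.sumCongr e2 e1).trans
    (Equiv.sumCompl (TopInColumn hn))), fun i => ?_, fun i => ?_⟩
  · exact (e1 i).2
  · exact (e2 i).2

/-! ### The entries of the Gram matrix -/

theorem minor_eq_ite {k : ℕ} {c t : Fin k → Fin n} (hc : StrictMono c) (ht : StrictMono t) :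
    minor c t = if c = t then 1 else 0 := by
  split_ifs with h
  · subst h
    rw [minor, ← Matrix.det_one (n := Fin k)]
    congr 1
    ext i j
    simp [Matrix.one_apply, hc.injective.eq_iff]
  -- Distinct increasing tuples of equal length have different ranges of equal size, so some `c i`
  -- is missing from `t` and gives a zero row.
  · have hne : ¬ Set.range c ⊆ Set.range t := by
      intro hs
      refine h ((hc.range_inj ht).1 ?_)
      refine Set.eq_of_subset_of_ncard_le hs ?_ (Set.finite_range t)
      rw [← Set.image_univ, ← Set.image_univ, Set.ncard_image_of_injective _ ht.injective,
        Set.ncard_image_of_injective _ hc.injective]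
    obtain ⟨_, ⟨i, rfl⟩, hi⟩ := Set.not_subset.1 hne
    refine Matrix.det_eq_zero_of_row_eq_zero i fun j => ?_
    rw [Matrix.of_apply, if_neg fun hij => hi ⟨j, hij.symm⟩]

theorem coef_cons_of_notMem (a : Fin n) (c t : Fin l → Fin n) (h : ∀ j, a ≠ t j) :
    coef (Fin.cons a c) t = minor c t := by
  rw [coef, Matrix.det_succ_row_zero, Fin.sum_univ_succ, Finset.sum_eq_zero]
  · simp only [borderedIncidence, Fin.val_zero, pow_zero, one_mul, Matrix.of_apply, Fin.cons_zero,
      add_zero]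
    rfl
  · intro j _
    simp [borderedIncidence, h j]

theorem coef_eq_zero (b : Fin (l + 1) → Fin n) (t : Fin l → Fin n) (j : Fin l)
    (h : ∀ i, b i ≠ t j) : coef b t = 0 :=
  Matrix.det_eq_zero_of_column_eq_zero j.succ fun i => by simp [borderedIncidence, h i]

theorem yElt_eq (hn : 2 ≤ n) (T : StandardHook n l) :
    yElt T = hookPoly (Fin.cons (first hn) (lowerColumn T.1)) := by
  rw [← firstColumn_eq, hookPoly_eq, yElt]

theorem value_yElt (hn : 2 ≤ n) (t : Fin l → Fin n) (T : StandardHook n l) :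
    value t (yElt T) = coef (Fin.cons (first hn) (lowerColumn T.1)) t := by
  rw [yElt, value_poly, firstColumn_eq hn]

open Classical in
-- The row of the entry `1` is `(1, 0, …, 0)`, which reduces the determinant to a minor of two
-- increasing tuples.
theorem value_lowerColumn_yElt (hn : 2 ≤ n) (hl : l < n) (T T' : StandardHook n l) :
    value (lowerColumn T.1) (yElt T') = if T = T' then 1 else 0 := by
  rw [value_yElt hn, coef_cons_of_notMem _ _ _ fun j => (first_lt_lowerColumn hn T j).ne,
    minor_eq_ite (strictMono_lowerColumn T') (strictMono_lowerColumn T)]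
  refine if_congr ⟨fun h => standard_ext hn hl h.symm, fun h => by rw [h]⟩ rfl rfl

theorem hookPoly_eq_zero (hl : l < n) (b : Fin (l + 1) → Fin n) (hb : ¬ Function.Injective b) :
    hookPoly b = 0 := by
  rw [hookPoly, dif_neg]
  rwa [exists_firstColumn_eq hl]

theorem hookPoly_cons_eq_zero (hl : l < n) (a : Fin n) (c : Fin l → Fin n)
    (h : a ∈ Set.range c) : hookPoly (Fin.cons a c : Fin (l + 1) → Fin n) = 0 :=
  hookPoly_eq_zero hl _ fun hb => (Fin.cons_injective_iff.1 hb).1 h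

/-- The added summands have a repeated entry and vanish; the full sum is what
`form_sum_hookPoly_cons` needs. -/
theorem xElt_of_topInColumn (hn : 2 ≤ n) (hl : l < n) (T : StandardHook n l)
    (h : TopInColumn hn T) : xElt hn T = ∑ s, hookPoly (Fin.cons s (lowerColumn T.1)) := by
  rw [xElt, if_pos h]
  refine Finset.sum_subset (Finset.subset_univ _) fun s _ hs => hookPoly_cons_eq_zero hl _ _ ?_
  simpa using hs

theorem xElt_of_not_topInColumn (hn : 2 ≤ n) (T : StandardHook n l) (h : ¬ TopInColumn hn T) :
    xElt hn T = hookPoly (Fin.cons (top hn) (lowerColumn T.1)) := by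
  rw [xElt, if_neg h]

open Classical in
theorem form_xElt_of_topInColumn (hn : 2 ≤ n) (hl : l < n) (T T' : StandardHook n l)
    (h : TopInColumn hn T) :
    form (hook n l) n (xElt hn T) (yElt T') = if T = T' then (n * l ! : ℤ) else 0 := by
  rw [xElt_of_topInColumn hn hl T h, form_sum_hookPoly_cons hl, value_lowerColumn_yElt hn hl]
  split_ifs <;> simp

theorem dvd_form_xElt (hn : 2 ≤ n) (hl : l < n) (T : StandardHook n l)
    (h : ¬ TopInColumn hn T) (v : lattice (hook n l) n) :
    (l ! : ℤ) ∣ form (hook n l) n (xElt hn T) v := by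
  rw [xElt_of_not_topInColumn hn T h, form_hookPoly hl]
  exact dvd_mul_right _ _

open Classical in
theorem form_xElt_of_not_topInColumn (hn : 2 ≤ n) (hl : l < n) (T T' : StandardHook n l)
    (h : ¬ TopInColumn hn T) (h' : ¬ TopInColumn hn T') :
    form (hook n l) n (xElt hn T) (yElt T') = if T = T' then (l ! : ℤ) else 0 := by
  rw [xElt_of_not_topInColumn hn T h, form_hookPoly hl, Fin.sum_univ_succ,
    cons_comp_succAbove_zero, value_lowerColumn_yElt hn hl, Finset.sum_eq_zero]
  · simp
  · intro i _
    obtain _ | l := l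
    · exact i.elim0
    -- These faces begin with `n`, which is absent from the first column of `T'`; the determinant
    -- has a zero column.
    · rw [cons_comp_succAbove_succ, value_yElt hn, coef_eq_zero _ _ 0, mul_zero]
      intro j
      rw [Fin.cons_zero, ← firstColumn_eq]
      exact fun hj => h' ⟨j, hj⟩

/-! ### Both families are bases -/

theorem hookPoly_cons_comp_perm (hl : l < n) (a : Fin n) (c : Fin l → Fin n)
    (π : Equiv.Perm (Fin l)) :
    hookPoly (Fin.cons a (c ∘ π) : Fin (l + 1) → Fin n) =
      (Equiv.Perm.sign π : ℤ) • hookPoly (Fin.cons a c : Fin (l + 1) → Fin n) := by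
  have h : (Fin.cons a (c ∘ π) : Fin (l + 1) → Fin n) =
      -- The permutation `decomposeFin.symm (0, π)` fixes `0` and acts as `π` on the successors.
      (Fin.cons a c : Fin (l + 1) → Fin n) ∘ Equiv.Perm.decomposeFin.symm (0, π) := by
    ext j
    refine Fin.cases ?_ (fun j => ?_) j <;> simp
  rw [h, hookPoly_comp_perm hl, Equiv.Perm.decomposeFin.symm_sign]
  simp

/-- Sorting `c` changes the polytabloid only by a sign, and a repeated entry makes it zero. -/
theorem hookPoly_cons_mem (hl : l < n) (N : Submodule ℤ (lattice (hook n l) n)) (a : Fin n)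
    (c : Fin l → Fin n) (h : ∀ π : Equiv.Perm (Fin l), StrictMono (c ∘ π) → (∀ i, c i ≠ a) →
      hookPoly (Fin.cons a (c ∘ π) : Fin (l + 1) → Fin n) ∈ N) :
    hookPoly (Fin.cons a c : Fin (l + 1) → Fin n) ∈ N := by
  by_cases hc : Function.Injective (Fin.cons a c : Fin (l + 1) → Fin n)
  · obtain ⟨ha, hc⟩ := Fin.cons_injective_iff.1 hc
    have := N.smul_mem (Equiv.Perm.sign (Tuple.sort c) : ℤ) (h (Tuple.sort c)
      ((Tuple.monotone_sort c).strictMono_of_injective (hc.comp (Tuple.sort c).injective))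
      fun i hi => ha ⟨i, hi⟩)
    rwa [hookPoly_cons_comp_perm hl, smul_smul, ← Units.val_mul, Int.units_mul_self,
      Units.val_one, one_smul] at this
  · rw [hookPoly_eq_zero hl _ hc]
    exact N.zero_mem

theorem eq_top_of_hookPoly_cons_mem (hl : l < n) (N : Submodule ℤ (lattice (hook n l) n))
    (a : Fin n) (h : ∀ c : Fin l → Fin n, StrictMono c → (∀ i, c i ≠ a) →
      hookPoly (Fin.cons a c : Fin (l + 1) → Fin n) ∈ N) : N = ⊤ := by
  refine eq_top_iff.2 fun v _ => ?_
  induction v using lattice_induction with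
  | poly T =>
    rw [← hookPoly_eq, hookPoly_eq_sum hl a]
    exact N.sum_mem fun i _ => N.smul_mem _ (hookPoly_cons_mem hl N a _ fun π hπ ha =>
      h _ hπ fun i => ha (π i))
  | zero => exact N.zero_mem
  | add u v hu hv => exact N.add_mem (hu trivial) (hv trivial)
  | smul a u hu => exact N.smul_mem a (hu trivial)

theorem first_lt_of_ne (hn : 2 ≤ n) {e : Fin n} (h : e ≠ first hn) : first hn < e :=
  lt_of_le_of_ne (Nat.zero_le _) h.symm

theorem lt_top_of_ne (hn : 2 ≤ n) {e : Fin n} (h : e ≠ top hn) : e < top hn :=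
  lt_of_le_of_ne (Nat.le_sub_one_of_lt e.2) h

theorem span_yElt (hn : 2 ≤ n) (hl : l < n) :
    Submodule.span ℤ (Set.range (yElt (n := n) (l := l))) = ⊤ := by
  refine eq_top_of_hookPoly_cons_mem hl _ (first hn) fun c hc h => ?_
  obtain ⟨T, rfl⟩ := exists_standard hn hl c hc fun i => first_lt_of_ne hn (h i)
  rw [← yElt_eq]
  exact Submodule.subset_span ⟨T, rfl⟩

theorem hookPoly_cons_top_mem_span_xElt (hn : 2 ≤ n) (hl : l < n) (c : Fin l → Fin n)
    (h : ∀ i, c i ≠ first hn) : hookPoly (Fin.cons (top hn) c : Fin (l + 1) → Fin n) ∈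
      Submodule.span ℤ (Set.range (xElt (l := l) hn)) := by
  refine hookPoly_cons_mem hl _ _ _ fun π hπ ht => ?_
  obtain ⟨T, hT⟩ := exists_standard hn hl _ hπ fun i => first_lt_of_ne hn (h (π i))
  rw [← hT, ← xElt_of_not_topInColumn hn T]
  · exact Submodule.subset_span ⟨T, rfl⟩
  · rw [topInColumn_iff, hT]
    rintro ⟨i, hi⟩
    exact ht _ hi

theorem strictMono_snoc {k : ℕ} {a : Fin n} {d : Fin k → Fin n} (ha : ∀ j, d j < a)
    (hd : StrictMono d) : StrictMono (Fin.snoc d a : Fin (k + 1) → Fin n) := by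
  intro i j hij
  obtain ⟨i, rfl⟩ := Fin.exists_castSucc_eq.2 (hij.trans_le (Fin.le_last j)).ne
  rw [Fin.snoc_castSucc (α := fun _ => Fin n)]
  induction j using Fin.lastCases with
  | last => simpa using ha i
  | cast j => simpa using hd (Fin.castSucc_lt_castSucc_iff.1 hij)

/-- Straightening with respect to `n` leaves the `⟨n, c⟩` with `c` increasing. If `1` is not in `c`,
this is some `x_i`. If `c = (1, d)`, it is isolated from the `x_i` with lower column `(d, n)`. -/
theorem span_xElt (hn : 2 ≤ n) (hl : l < n) :
    Submodule.span ℤ (Set.range (xElt (l := l) hn)) = ⊤ := by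
  refine eq_top_of_hookPoly_cons_mem hl _ (top hn) fun c hc ht => ?_
  by_cases h : ∀ i, c i ≠ first hn
  · exact hookPoly_cons_top_mem_span_xElt hn hl c h
  push Not at h
  obtain ⟨i, hi⟩ := h
  obtain _ | k := l
  · exact i.elim0
  obtain ⟨a, d, rfl⟩ : ∃ a d, c = Fin.cons a d := ⟨_, _, (Fin.cons_self_tail c).symm⟩
  have ha : a = first hn := by
    have : (Fin.cons a d : Fin (k + 1) → Fin n) 0 ≤ (Fin.cons a d : Fin (k + 1) → Fin n) i :=
      hc.monotone (Fin.zero_le i)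
    rw [hi, Fin.cons_zero] at this
    exact le_antisymm this (Nat.zero_le _)
  subst ha
  obtain ⟨hd0, hd⟩ := Fin.strictMono_cons.1 hc
  have hd1 : ∀ j, d j < top hn := fun j => lt_top_of_ne hn (by simpa using ht j.succ)
  obtain ⟨T, hT⟩ := exists_standard hn hl (Fin.snoc d (top hn))
    (strictMono_snoc hd1 hd) fun j => by
      refine Fin.lastCases ?_ (fun j => ?_) j
      · rw [Fin.snoc_last]
        exact first_lt_of_ne hn (first_ne_top hn).symm
      · rw [Fin.snoc_castSucc]
        exact hd0 j
  have hx : xElt hn T ∈ Submodule.span ℤ (Set.range (xElt (l := k + 1) hn)) :=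
    Submodule.subset_span ⟨T, rfl⟩
  -- Rotating `n` to the front costs a sign that does not depend on `s`.
  have hr : ∀ s, hookPoly (Fin.cons s (Fin.snoc d (top hn) : Fin (k + 1) → Fin n)) =
      (Equiv.Perm.sign (finRotate (k + 1 + 1)) : ℤ) •
        hookPoly (Fin.cons (top hn) (Fin.cons s d : Fin (k + 1) → Fin n)) := by
    intro s
    rw [← hookPoly_comp_perm hl, Fin.cons_snoc_eq_snoc_cons, Fin.snoc_eq_cons_rotate]
    rfl
  rw [xElt_of_topInColumn hn hl T ((topInColumn_iff hn T).2 ⟨Fin.last _, by rw [hT]; simp⟩), hT,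
    Finset.sum_congr rfl fun s _ => hr s, ← Finset.smul_sum] at hx
  replace hx := Submodule.smul_mem _ (Equiv.Perm.sign (finRotate (k + 1 + 1)) : ℤ) hx
  rw [smul_smul, ← Units.val_mul, Int.units_mul_self, Units.val_one, one_smul,
    ← Finset.add_sum_erase _ _ (Finset.mem_univ (first hn))] at hx
  -- Every summand with `s ≠ 1` has no `1` below its top entry, hence is already in the span; so the
  -- summand `s = 1` is too.
  refine (Submodule.add_mem_iff_left _ (Submodule.sum_mem _ fun s hs => ?_)).1 hx
  refine hookPoly_cons_top_mem_span_xElt hn hl _ fun i => ?_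
  refine Fin.cases ?_ (fun i => ?_) i
  · simpa using Finset.ne_of_mem_erase hs
  · simpa using (hd0 i).ne'

theorem linearIndependent_yElt (hn : 2 ≤ n) (hl : l < n) :
    LinearIndependent ℤ (yElt (n := n) (l := l)) := by
  classical
  have := Fintype.ofFinite (StandardHook n l)
  refine Fintype.linearIndependent_iff.2 fun g hg T => ?_
  have := congrArg (value (lowerColumn T.1)) hg
  simpa [value_lowerColumn_yElt hn hl] using this

/-- The standard polytabloids form a basis of the Specht lattice. -/
noncomputable def yBasis (hn : 2 ≤ n) (hl : l < n) :
    Module.Basis (StandardHook n l) ℤ (lattice (hook n l) n) :=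
  Module.Basis.mk (linearIndependent_yElt hn hl) (span_yElt hn hl).ge

theorem yBasis_apply (hn : 2 ≤ n) (hl : l < n) (T : StandardHook n l) :
    yBasis hn hl T = yElt T := Module.Basis.mk_apply _ _ _

/-- A generating family indexed by a finite basis is linearly independent. -/
theorem linearIndependent_of_span_eq_top {ι R M : Type*} [CommRing R] [AddCommGroup M] [Module R M]
    [Finite ι] (b : Module.Basis ι R M) (x : ι → M) (hx : Submodule.span R (Set.range x) = ⊤) :
    LinearIndependent R x := by
  have := Module.Finite.of_basis b
  have hs : Function.Surjective (b.constr R x) := by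
    rw [← LinearMap.range_eq_top, Module.Basis.constr_range, hx]
  have hi := OrzechProperty.injective_of_surjective_endomorphism _ hs
  have := b.linearIndependent.map' _ (LinearMap.ker_eq_bot.2 hi)
  rwa [show b.constr R x ∘ b = x from funext fun i => b.constr_basis R x i] at this

theorem linearIndependent_xElt (hn : 2 ≤ n) (hl : l < n) :
    LinearIndependent ℤ (xElt (l := l) hn) :=
  linearIndependent_of_span_eq_top (yBasis hn hl) _ (span_xElt hn hl)

/-! ### Determinant and cokernel of a block triangular form -/

/-- The determinants of the matrices of a bilinear form with respect to different bases differ only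
by a sign. -/
theorem prod_diag_eq_det_or_neg {X : Type*} [AddCommGroup X] {m : ℕ}
    (B : LinearMap.BilinForm ℤ X) (x y b : Module.Basis (Fin m) ℤ X)
    (h : ∀ i j, j < i → B (x i) (y j) = 0) :
    ∏ i, B (x i) (y i) = (Matrix.of fun i j => B (b i) (b j)).det ∨
    ∏ i, B (x i) (y i) = -(Matrix.of fun i j => B (b i) (b j)).det := by
  have h1 : ∏ i, B (x i) (y i) = (LinearMap.toMatrix₂ x y B).det := by
    rw [Matrix.det_of_isUpperTriangular]
    · simp
    · intro i j hij
      simpa using h i j hij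
  have h2 : (Matrix.of fun i j => B (b i) (b j)) = LinearMap.toMatrix₂ b b B := by
    ext i j
    simp
  -- Base change matrices over `ℤ` have unit determinant.
  have hu : ∀ z : Module.Basis (Fin m) ℤ X,
      (b.toMatrix z).det = 1 ∨ (b.toMatrix z).det = -1 := by
    intro z
    have := b.isUnit_det z
    rwa [Module.Basis.det_apply, Int.isUnit_iff] at this
  rw [h1, h2, ← LinearMap.toMatrix₂_mul_basis_toMatrix (b₁ := b) (b₂ := b) x y B, Matrix.det_mul,
    Matrix.det_mul, Matrix.det_transpose]
  rcases hu x with hx | hx <;> rcases hu y with hy | hy <;> simp [hx, hy]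

/-- The cokernel of a bilinear form with a block triangular Gram matrix whose diagonal blocks are
scalar and whose upper right block is divisible by the scalar of the upper left one. -/
theorem nonempty_cokernel_addEquiv {X α β : Type*} [AddCommGroup X] [Fintype α] [Fintype β]
    [DecidableEq α] [DecidableEq β] (B : LinearMap.BilinForm ℤ X) (p q : ℕ) (x : α ⊕ β → X)
    (y : Module.Basis (α ⊕ β) ℤ X) (hx : Submodule.span ℤ (Set.range x) = ⊤)
    (h11 : ∀ i i', B (x (.inl i)) (y (.inl i')) = if i = i' then (p : ℤ) else 0)
    (h12 : ∀ i j, (p : ℤ) ∣ B (x (.inl i)) (y (.inr j)))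
    (h21 : ∀ j i, B (x (.inr j)) (y (.inl i)) = 0)
    (h22 : ∀ j j', B (x (.inr j)) (y (.inr j')) = if j = j' then (q : ℤ) else 0) :
    Nonempty ((Module.Dual ℤ X ⧸ LinearMap.range B) ≃+ (α → ZMod p) × (β → ZMod q)) := by
  choose A hA using h12
  -- With the upper right block equal to `p * A`, subtracting `A`-multiples of the first block of
  -- columns clears it; `F` reads off the remaining diagonal form modulo `p` and `q`.
  let F : Module.Dual ℤ X →+ (α → ZMod p) × (β → ZMod q) :=
    { toFun := fun g => (fun i => (g (y (.inl i)) : ZMod p),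
        fun j => ((g (y (.inr j)) - ∑ i, g (y (.inl i)) * A i j : ℤ) : ZMod q))
      map_zero' := by ext <;> simp
      map_add' := fun g g' => by
        ext
        · simp
        · simp [add_mul, Finset.sum_add_distrib]
          ring }
  let f : Module.Dual ℤ X →ₗ[ℤ] (α → ZMod p) × (β → ZMod q) := F.toIntLinearMap
  have hf1 : ∀ g i, (f g).1 i = (g (y (.inl i)) : ZMod p) := fun _ _ => rfl
  have hf2 : ∀ g j, (f g).2 j =
    ((g (y (.inr j)) - ∑ i, g (y (.inl i)) * A i j : ℤ) : ZMod q) := fun _ _ => rfl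
  have hsurj : Function.Surjective f := by
    rintro ⟨u, v⟩
    choose u' hu using fun i => ZMod.intCast_surjective (u i)
    choose v' hv using fun j => ZMod.intCast_surjective (v j)
    refine ⟨y.constr ℤ (Sum.elim u' fun j => v' j + ∑ i, u' i * A i j), ?_⟩
    refine Prod.ext (funext fun i => ?_) (funext fun j => ?_)
    · rw [hf1, y.constr_basis, Sum.elim_inl, hu]
    · simp only [hf2, y.constr_basis, Sum.elim_inl, Sum.elim_inr, add_sub_cancel_right, hv]
  have hker : LinearMap.ker f = LinearMap.range B := by
    apply le_antisymm
    · intro g hg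
      rw [LinearMap.mem_ker] at hg
      have h1 : ∀ i, (p : ℤ) ∣ g (y (.inl i)) := fun i => by
        rw [← ZMod.intCast_zmod_eq_zero_iff_dvd, ← hf1, hg]
        rfl
      have h2 : ∀ j, (q : ℤ) ∣ g (y (.inr j)) - ∑ i, g (y (.inl i)) * A i j := fun j => by
        rw [← ZMod.intCast_zmod_eq_zero_iff_dvd, ← hf2, hg]
        rfl
      -- The quotients by `p` and `q` are the coefficients of a preimage in terms of `x`.
      choose a ha using h1
      choose b hb using h2
      refine ⟨∑ i, a i • x (.inl i) + ∑ j, b j • x (.inr j), y.ext ?_⟩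
      rintro (i | j)
      · simp [h11, h21, ha, mul_comm]
      · have := hb j
        simp only [ha] at this
        simp [hA, h22, mul_comm (b _), sub_eq_iff_eq_add.1 this]
        rw [add_comm]
        congr 1
        exact Finset.sum_congr rfl fun i _ => by ring
    · rw [LinearMap.range_eq_map, ← hx, Submodule.map_span_le]
      rintro _ ⟨i | j, rfl⟩
      · refine LinearMap.mem_ker.2 (Prod.ext (funext fun i' => ?_) (funext fun j => ?_))
        · rw [hf1, h11]
          split_ifs <;> simp
        · rw [hf2]
          simp [h11, hA]
      · refine LinearMap.mem_ker.2 (Prod.ext (funext fun i => ?_) (funext fun j' => ?_))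
        · rw [hf1, h21]
          simp
        · rw [hf2]
          simp only [h21, h22, zero_mul, Finset.sum_const_zero, sub_zero]
          split_ifs <;> simp
  exact ⟨((Submodule.quotEquivOfEq _ _ hker.symm).trans
    (f.quotKerEquivOfSurjective hsurj)).toAddEquiv⟩

/-! ### The discriminant group and the trigonalization -/

theorem nonempty_dualQuotient_addEquiv (hn : 2 ≤ n) (hl : l < n) :
    Nonempty (DualQuotient (hook n l) n ≃+ (Fin ((n - 2).choose l) → ZMod (l !)) ×
      (Fin (if l = 0 then 0 else (n - 2).choose (l - 1)) → ZMod (n * l !))) := by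
  classical
  obtain ⟨T, h1, h2⟩ := exists_sum_equiv hn hl
  have hy : ∀ i, (yBasis hn hl).reindex T.symm i = yElt (T i) := fun i => by
    simp [yBasis_apply]
  refine nonempty_cokernel_addEquiv _ _ _ (xElt hn ∘ T) ((yBasis hn hl).reindex T.symm) ?_ ?_ ?_
    ?_ ?_
  · rw [T.surjective.range_comp, span_xElt hn hl]
  · intro i i'
    simp [hy, form_xElt_of_not_topInColumn hn hl _ _ (h1 i) (h1 i')]
  · exact fun i j => dvd_form_xElt hn hl _ (h1 i) _
  · intro j i
    simp [hy, form_xElt_of_topInColumn hn hl _ _ (h2 j)]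
  · intro j j'
    simp [hy, form_xElt_of_topInColumn hn hl _ _ (h2 j)]

theorem form_xElt_self_of_topInColumn (hn : 2 ≤ n) (hl : l < n) (T : StandardHook n l)
    (h : TopInColumn hn T) : form (hook n l) n (xElt hn T) (yElt T) = (n * l ! : ℤ) := by
  rw [form_xElt_of_topInColumn hn hl T T h, if_pos rfl]

theorem form_xElt_self_of_not_topInColumn (hn : 2 ≤ n) (hl : l < n) (T : StandardHook n l)
    (h : ¬ TopInColumn hn T) : form (hook n l) n (xElt hn T) (yElt T) = (l ! : ℤ) := by
  rw [form_xElt_of_not_topInColumn hn hl T T h h, if_pos rfl]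

theorem isIntBasis_xElt (hn : 2 ≤ n) (hl : l < n) {m : ℕ} (T : Fin m ≃ StandardHook n l) :
    IsIntBasis fun i => xElt hn (T i) :=
  ⟨(linearIndependent_xElt hn hl).comp T T.injective, by
    rw [← span_xElt hn hl, ← T.surjective.range_comp]
    rfl⟩

theorem isIntBasis_yElt (hn : 2 ≤ n) (hl : l < n) {m : ℕ} (T : Fin m ≃ StandardHook n l) :
    IsIntBasis fun i => yElt (T i) :=
  ⟨(linearIndependent_yElt hn hl).comp T T.injective, by
    rw [← span_yElt hn hl, ← T.surjective.range_comp]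
    rfl⟩

theorem trigonalizes_xElt_yElt (hn : 2 ≤ n) (hl : l < n) {m : ℕ} (T : Fin m ≃ StandardHook n l)
    (hT : ∀ i j, ¬ TopInColumn hn (T i) → TopInColumn hn (T j) → i < j) :
    Trigonalizes (form (hook n l) n) (fun i => xElt hn (T i)) (fun i => yElt (T i)) := by
  have hlower : ∀ i j, j < i → form (hook n l) n (xElt hn (T i)) (yElt (T j)) = 0 := by
    intro i j hij
    by_cases hi : TopInColumn hn (T i)
    · rw [form_xElt_of_topInColumn hn hl _ _ hi, if_neg (T.injective.ne hij.ne')]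
    · have hj : ¬ TopInColumn hn (T j) := fun hj => lt_asymm hij (hT i j hi hj)
      rw [form_xElt_of_not_topInColumn hn hl _ _ hi hj, if_neg (T.injective.ne hij.ne')]
  constructor
  · intro i
    by_cases hi : TopInColumn hn (T i)
    · rw [form_xElt_self_of_topInColumn hn hl _ hi]
      have := Nat.factorial_ne_zero l
      have : n ≠ 0 := by omega
      positivity
    · rw [form_xElt_self_of_not_topInColumn hn hl _ hi]
      positivity
  · exact hlower
  · intro i j hij
    by_cases hi : TopInColumn hn (T i)
    · rw [form_xElt_of_topInColumn hn hl _ (T j) hi, if_neg (T.injective.ne hij.ne)]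
      exact dvd_zero _
    · rw [form_xElt_self_of_not_topInColumn hn hl _ hi]
      exact dvd_form_xElt hn hl _ hi _
  · intro i h
    by_cases hi : TopInColumn hn (T ⟨i, Nat.lt_of_succ_lt h⟩)
    · have hi' : TopInColumn hn (T ⟨i + 1, h⟩) := by
        by_contra hc
        have := hT _ _ hc hi
        rw [Fin.mk_lt_mk] at this
        omega
      rw [form_xElt_self_of_topInColumn hn hl _ hi, form_xElt_self_of_topInColumn hn hl _ hi']
    · rw [form_xElt_self_of_not_topInColumn hn hl _ hi]
      by_cases hi' : TopInColumn hn (T ⟨i + 1, h⟩)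
      · rw [form_xElt_self_of_topInColumn hn hl _ hi']
        exact dvd_mul_left _ _
      · rw [form_xElt_self_of_not_topInColumn hn hl _ hi']
  · intro b
    have hx := isIntBasis_xElt hn hl T
    have hy := isIntBasis_yElt hn hl T
    have := prod_diag_eq_det_or_neg (form (hook n l) n) (Module.Basis.mk hx.1 hx.2.ge)
      (Module.Basis.mk hy.1 hy.2.ge) b
    simp only [Module.Basis.mk_apply] at this
    exact this hlower

end Specht

theorem mainTheorem7 (n l : ℕ) (hn : 2 ≤ n) (hl : l < n) :
    Nonempty (Specht.DualQuotient (Specht.hook n l) n ≃+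
      (Fin ((n - 2).choose l) → ZMod (l !)) ×
      (Fin (if l = 0 then 0 else (n - 2).choose (l - 1)) → ZMod (n * l !))) ∧
    ∀ (m : ℕ) (T : Fin m ≃ Specht.StandardHook n l),
      (∀ i j, ¬ Specht.TopInColumn hn (T i) → Specht.TopInColumn hn (T j) → i < j) →
      Specht.IsIntBasis (fun i => Specht.xElt hn (T i)) ∧
      Specht.IsIntBasis (fun i => Specht.yElt (T i)) ∧
      Specht.Trigonalizes (Specht.form (Specht.hook n l) n)
        (fun i => Specht.xElt hn (T i)) (fun i => Specht.yElt (T i)) ∧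
      (∀ i, ¬ Specht.TopInColumn hn (T i) →
        Specht.form (Specht.hook n l) n (Specht.xElt hn (T i)) (Specht.yElt (T i)) = (l ! : ℤ)) ∧
      (∀ i, Specht.TopInColumn hn (T i) →
        Specht.form (Specht.hook n l) n (Specht.xElt hn (T i)) (Specht.yElt (T i))
          = (n * l ! : ℤ)) :=
  ⟨Specht.nonempty_dualQuotient_addEquiv hn hl, fun _ T hT =>
    ⟨Specht.isIntBasis_xElt hn hl T, Specht.isIntBasis_yElt hn hl T,
      Specht.trigonalizes_xElt_yElt hn hl T hT,
      fun _ h => Specht.form_xElt_self_of_not_topInColumn hn hl _ h,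
      fun _ h => Specht.form_xElt_self_of_topInColumn hn hl _ h⟩⟩
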